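/- **Setting.** On an open set of $\mathbb R^5$ with coordinates $u^\alpha=(x^1,x^2,x^3,v=y^4,y^5)$ consider the metric $$ds^2=g_1(dx^1)^2+g_2(dx^2)^2+g_3(dx^3)^2+h_4\,(dv+w_i\,dx^i)^2+h_5\,(dy^5+n_i\,dx^i)^2 ,\qquad(1)$$ where $g_1=\pm1$, the functions $g_2,g_3$ depend only on $(x^2,x^3)$, the functions $h_4,h_5,w_i,n_i$ depend only on $(x^1,x^2,x^3,v)$, all of them are of class $C^2$, and $g_2,g_3,h_4,h_5$ vanish nowhere (the signature is arbitrary). Put $N_i^4=w_i$, $N_i^5=n_i$ and use the frame $\delta_i=\partial_i-N_i^a\partial_a$, $\delta_a=\partial_a$ ($i=1,2,3$, $a=4,5$), dual to $(dx^i,\;dy^a+N_i^a dx^i)$, in which the metric has the blocks $g_{ij}$, $h_{ab}$. Let $D_{\delta_\gamma}\delta_\beta=\Gamma^\alpha_{\ \beta\gamma}\delta_\alpha$ be the canonical d-connection, whose only nonzero coefficients are $$L^i_{jk}=\tfrac12 g^{im}(\delta_kg_{mj}+\delta_jg_{mk}-\delta_mg_{jk}),\qquad L^a_{bk}=\partial_bN^a_k+\tfrac12h^{ac}(\delta_kh_{bc}-h_{dc}\,\partial_bN^d_k-h_{db}\,\partial_cN^d_k),$$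 $$C^i_{jc}=\tfrac12g^{ik}\partial_cg_{jk},\qquad C^a_{bc}=\tfrac12h^{ad}(\partial_ch_{db}+\partial_bh_{dc}-\partial_dh_{bc}).$$ Let $R_\beta{}^\alpha{}_{\gamma\tau}$ be its curvature, $R(\delta_\tau,\delta_\gamma)\delta_\beta=R_\beta{}^\alpha{}_{\gamma\tau}\delta_\alpha$, let $R_{\beta\gamma}=R_\beta{}^\alpha{}_{\gamma\alpha}$ be its Ricci tensor, $R^\alpha_\beta=g^{\alpha\gamma}R_{\gamma\beta}$ (with $S^a_b:=R^a_b$ for $a,b\in\{4,5\}$) and $R=g^{\alpha\beta}R_{\alpha\beta}$. With a coupling constant $\kappa\ne0$ and a source $\Upsilon$, the Einstein equations are $R_{\alpha\beta}-\frac12g_{\alpha\beta}R=\kappa\Upsilon_{\alpha\beta}$, where $\Upsilon_{\alpha\beta}=g_{\alpha\gamma}\Upsilon^\gamma_\beta$; all components refer to the frame above. The diagonal Einstein equations are $R^\alpha_\alpha-\frac12R=\kappa\Upsilon^\alpha_\alpha$ (no summation). **Corollary 4.** Let $\Lambda\in\mathbb R$. (i) The 5D diagonal source $\kappa\Upsilon^\alpha_\beta=\mathrm{diag}(2\Lambda,\Lambda,\Lambda,\Lambda,\Lambda)$,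 that is $\kappa\Upsilon_{\alpha\beta}=(2\Lambda g_{11},\Lambda g_{\underline\alpha\underline\beta})$ with $\underline\alpha,\underline\beta\in\{2,3,4,5\}$, satisfies the compatibility conditions $\Upsilon^1_1=\Upsilon^2_2+\Upsilon^4_4$, $\Upsilon^2_2=\Upsilon^3_3$, $\Upsilon^4_4=\Upsilon^5_5$. The 4D source $\kappa\Upsilon^{\underline\alpha}_{\underline\beta}=\Lambda\delta^{\underline\alpha}_{\underline\beta}$ satisfies $\Upsilon^2_2=\Upsilon^3_3$, $\Upsilon^4_4=\Upsilon^5_5$. (ii) For the metric (1) and the 5D source of (i), at every point the diagonal Einstein equations hold if and only if $$R^2_2=S^4_4=-\Lambda ,\qquad(2)$$ and the full system of Einstein equations holds if and only if (2) and the mixed equations $R_{4i}=R_{5i}=0$, $i=1,2,3$, hold. (iii) The same holds in four dimensions, with $x^1$ and $g_1$ removed ($g_2,g_3$ depend on $(x^2,x^3)$; $h_4,h_5,w_i,n_i$ depend on $(x^2,x^3,v)$; $i=2,3$) and the 4D source of (i). (iv) The same holds for the 5D and the 4D conformal ansatz $$ds^2=\Omega^2\Big[\sum_i g_i(dx^i)^2+h_4\,(dv+(w_i+\zeta_i)\,dx^i)^2+h_5\,(dy^5+n_i\,dx^i)^2\Big]$$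 with $N_i^4=w_i+\zeta_i$, $N_i^5=n_i$, where $\Omega\neq0$ and $\zeta_i$ are $C^2$ functions of $(x^i,v)$, provided that $\partial_i\Omega-(w_i+\zeta_i)\,\partial_v\Omega=0$ for all $i$ on the whole region. The frame, the canonical d-connection and the components $R^2_2,S^4_4,R_{4i},R_{5i}$ are then those of this conformal metric. -/

import Mathlib

/-! ### N-adapted frames and the canonical d-connection

Local coordinates on an `(n + 2)`-dimensional space are indexed by `Fin n ⊕ Fin 2`: the `n` holonomic
coordinates `x` come first, then the two anholonomic coordinates `(v, y⁵) = (y⁴, y⁵)`. -/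

/-- Indices: `Sum.inl i` is horizontal, `Sum.inr 0` is the index of `v = y⁴`, `Sum.inr 1` is that of `y⁵`. -/
abbrev Idx (n : ℕ) := Fin n ⊕ Fin 2

/-- The coordinate space. -/
abbrev Coord (n : ℕ) := Idx n → ℝ

/-- A (local, possibly indefinite) metric through its components in the coordinate frame. -/
abbrev MetricField (n : ℕ) := Coord n → Matrix (Idx n) (Idx n) ℝ

/-- N-coefficients `N a i = N_i^a`. -/
abbrev NCoeff (n : ℕ) := Fin 2 → Fin n → Coord n → ℝ

noncomputable section

/-- A function of `(x, v)` regarded as a function on the coordinate space. -/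
def liftXV {n : ℕ} (f : (Fin n → ℝ) → ℝ → ℝ) : Coord n → ℝ :=
  fun u => f (fun i => u (Sum.inl i)) (u (Sum.inr 0))

/-- The coordinate derivative `∂_α f`. -/
def pd {n : ℕ} (α : Idx n) (f : Coord n → ℝ) (u : Coord n) : ℝ :=
  fderiv ℝ f u (Pi.single α 1)

/-- The N-elongated frame `δ_i = ∂_i - N_i^a ∂_a`, `δ_a = ∂_a`, as vector fields. -/
def frame {n : ℕ} (N : NCoeff n) : Idx n → Coord n → Coord n
  | Sum.inl i => fun u =>
      Pi.single (Sum.inl i) 1 - ∑ a : Fin 2, N a i u • (Pi.single (Sum.inr a) 1 : Coord n)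
  | Sum.inr a => fun _ => Pi.single (Sum.inr a) 1

/-- The dual co-frame `dx^i`, `δy^a = dy^a + N_i^a dx^i`, evaluated on a vector `X` at `u`. -/
def coframe {n : ℕ} (N : NCoeff n) : Idx n → Coord n → Coord n → ℝ
  | Sum.inl i => fun _ X => X (Sum.inl i)
  | Sum.inr a => fun u X => X (Sum.inr a) + ∑ i : Fin n, N a i u * X (Sum.inl i)

/-- The N-elongated derivative `δ_α f`. -/
def elong {n : ℕ} (N : NCoeff n) (α : Idx n) (f : Coord n → ℝ) (u : Coord n) : ℝ :=
  fderiv ℝ f u (frame N α u)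

/-- Anholonomy coefficients `w^γ_{αβ}`: `[δ_α, δ_β] = w^γ_{αβ} δ_γ`. -/
def anholonomy {n : ℕ} (N : NCoeff n) (γ α β : Idx n) (u : Coord n) : ℝ :=
  coframe N γ u (VectorField.lieBracket ℝ (frame N α) (frame N β) u)

/-- Components `g(δ_α, δ_β)` of the metric in the N-elongated frame. -/
def frameMetric {n : ℕ} (G : MetricField n) (N : NCoeff n) : MetricField n :=
  fun u => Matrix.of fun α β => frame N α u ⬝ᵥ (G u).mulVec (frame N β u)

/-- The horizontal block `g_{ij}`. -/
def hBlock {n : ℕ} (G : MetricField n) (N : NCoeff n) (u : Coord n) : Matrix (Fin n) (Fin n) ℝ :=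
  (frameMetric G N u).toBlocks₁₁

/-- The vertical block `h_{ab}`. -/
def vBlock {n : ℕ} (G : MetricField n) (N : NCoeff n) (u : Coord n) : Matrix (Fin 2) (Fin 2) ℝ :=
  (frameMetric G N u).toBlocks₂₂

/-- Coefficients `Γ^α_{βγ}` of the canonical d-connection, `D_{δ_γ} δ_β = Γ^α_{βγ} δ_α`;
the four nontrivial cases are `L^i_{jk}`, `L^a_{bk}`, `C^i_{jc}`, `C^a_{bc}`. -/
def canonicalConnection {n : ℕ} (G : MetricField n) (N : NCoeff n) :
    Idx n → Idx n → Idx n → Coord n → ℝ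
  | Sum.inl i, Sum.inl j, Sum.inl k => fun u =>
      (1 / 2) * ∑ m : Fin n, (hBlock G N u)⁻¹ i m *
        (elong N (Sum.inl k) (fun x => hBlock G N x m j) u
          + elong N (Sum.inl j) (fun x => hBlock G N x m k) u
          - elong N (Sum.inl m) (fun x => hBlock G N x j k) u)
  | Sum.inr a, Sum.inr b, Sum.inl k => fun u =>
      pd (Sum.inr b) (N a k) u
        + (1 / 2) * ∑ c : Fin 2, (vBlock G N u)⁻¹ a c *
          (elong N (Sum.inl k) (fun x => vBlock G N x b c) u
            - (∑ d : Fin 2, vBlock G N u d c * pd (Sum.inr b) (N d k) u)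
            - ∑ d : Fin 2, vBlock G N u d b * pd (Sum.inr c) (N d k) u)
  | Sum.inl i, Sum.inl j, Sum.inr c => fun u =>
      (1 / 2) * ∑ k : Fin n, (hBlock G N u)⁻¹ i k * pd (Sum.inr c) (fun x => hBlock G N x j k) u
  | Sum.inr a, Sum.inr b, Sum.inr c => fun u =>
      (1 / 2) * ∑ d : Fin 2, (vBlock G N u)⁻¹ a d *
        (pd (Sum.inr c) (fun x => vBlock G N x d b) u
          + pd (Sum.inr b) (fun x => vBlock G N x d c) u
          - pd (Sum.inr d) (fun x => vBlock G N x b c) u)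
  | _, _, _ => fun _ => 0

/-- Curvature components `R_β^α_{γτ}`, where `R(δ_τ, δ_γ) δ_β = R_β^α_{γτ} δ_α`. -/
def curvature {n : ℕ} (G : MetricField n) (N : NCoeff n) (β α γ τ : Idx n) (u : Coord n) : ℝ :=
  elong N τ (canonicalConnection G N α β γ) u - elong N γ (canonicalConnection G N α β τ) u
    + ∑ φ : Idx n,
      (canonicalConnection G N φ β γ u * canonicalConnection G N α φ τ u
        - canonicalConnection G N φ β τ u * canonicalConnection G N α φ γ u
        + canonicalConnection G N α β φ u * anholonomy N φ γ τ u)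

/-- Ricci components `R_{βγ} = R_β^α_{γα}` in the N-elongated frame (not symmetric in general). -/
def ricci {n : ℕ} (G : MetricField n) (N : NCoeff n) (β γ : Idx n) (u : Coord n) : ℝ :=
  ∑ α : Idx n, curvature G N β α γ α u

/-- Mixed components `R^α_β = g^{αγ} R_{γβ}`; those with two vertical indices are written `S^a_b`. -/
def ricciMixed {n : ℕ} (G : MetricField n) (N : NCoeff n) (α β : Idx n) (u : Coord n) : ℝ :=
  ∑ γ : Idx n, (frameMetric G N u)⁻¹ α γ * ricci G N γ β u

/-- The scalar curvature `g^{αβ} R_{αβ}` of the canonical d-connection. -/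
def scalarCurv {n : ℕ} (G : MetricField n) (N : NCoeff n) (u : Coord n) : ℝ :=
  ∑ α : Idx n, ∑ β : Idx n, (frameMetric G N u)⁻¹ α β * ricci G N α β u

/-- All Einstein equations `R_{αβ} - ½ g_{αβ} R = κ Υ_{αβ}` at `u`, in the N-elongated frame, for a
source with constant mixed components `Υ^γ_β`, where `Υ_{αβ} = g_{αγ} Υ^γ_β`. -/
def EinsteinAt {n : ℕ} (G : MetricField n) (N : NCoeff n) (κ : ℝ) (Υ : Matrix (Idx n) (Idx n) ℝ)
    (u : Coord n) : Prop :=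
  ∀ α β : Idx n,
    ricci G N α β u - (1 / 2) * frameMetric G N u α β * scalarCurv G N u
      = κ * ∑ γ : Idx n, frameMetric G N u α γ * Υ γ β

/-- The diagonal Einstein equations `G^α_α = κ Υ^α_α` (no summation), `G^α_β = R^α_β - ½ R δ^α_β`. -/
def DiagEinsteinAt {n : ℕ} (G : MetricField n) (N : NCoeff n) (κ : ℝ)
    (Υ : Matrix (Idx n) (Idx n) ℝ) (u : Coord n) : Prop :=
  ∀ α : Idx n, ricciMixed G N α α u - (1 / 2) * scalarCurv G N u = κ * Υ α α

/-- The mixed horizontal-vertical equations `R_{4i} = 0` and `R_{5i} = 0`. -/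
def MixedRicciVanishAt {n : ℕ} (G : MetricField n) (N : NCoeff n) (u : Coord n) : Prop :=
  ∀ i : Fin n, ricci G N (Sum.inr 0) (Sum.inl i) u = 0 ∧ ricci G N (Sum.inr 1) (Sum.inl i) u = 0

/-! ### The ansatz -/

/-- The off-diagonal ansatz matrix in the coordinate frame, with horizontal coefficients `g`, vertical
coefficients `h₄, h₅` and N-coefficients `w, m`. -/
def ansatzMatrix {n : ℕ} (g : Fin n → Coord n → ℝ) (h₄ h₅ : Coord n → ℝ)
    (w m : Fin n → Coord n → ℝ) : MetricField n := fun u =>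
  Matrix.fromBlocks
    (Matrix.of fun i j => (if i = j then g i u else 0) + w i u * w j u * h₄ u + m i u * m j u * h₅ u)
    (Matrix.of fun i a => ![w i u * h₄ u, m i u * h₅ u] a)
    (Matrix.of fun a i => ![w i u * h₄ u, m i u * h₅ u] a)
    (Matrix.diagonal ![h₄ u, h₅ u])

/-- The coefficients `h₄, h₅, w_i, n_i` of the ansatz, functions of `(x, v)`, on a region `U`. -/
structure AnholonomicData (n : ℕ) (U : Set (Coord n)) where
  h₄ : (Fin n → ℝ) → ℝ → ℝ
  h₅ : (Fin n → ℝ) → ℝ → ℝ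
  w : Fin n → (Fin n → ℝ) → ℝ → ℝ
  nn : Fin n → (Fin n → ℝ) → ℝ → ℝ
  h₄_smooth : ContDiffOn ℝ 2 (liftXV h₄) U
  h₅_smooth : ContDiffOn ℝ 2 (liftXV h₅) U
  w_smooth : ∀ i, ContDiffOn ℝ 2 (liftXV (w i)) U
  nn_smooth : ∀ i, ContDiffOn ℝ 2 (liftXV (nn i)) U
  h₄_ne : ∀ u ∈ U, liftXV h₄ u ≠ 0
  h₅_ne : ∀ u ∈ U, liftXV h₅ u ≠ 0

/-- The 5D ansatz, in coordinates `(x¹, x², x³, v, y⁵)`: `g₁ = ±1`, and `g₂, g₃` depend on `(x², x³)`. -/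
structure Ansatz5 (U : Set (Coord 3)) extends AnholonomicData 3 U where
  g₁ : ℝ
  g₂ : ℝ → ℝ → ℝ
  g₃ : ℝ → ℝ → ℝ
  g₁_eq : g₁ = 1 ∨ g₁ = -1
  g₂_smooth : ContDiffOn ℝ 2 (fun u : Coord 3 => g₂ (u (Sum.inl 1)) (u (Sum.inl 2))) U
  g₃_smooth : ContDiffOn ℝ 2 (fun u : Coord 3 => g₃ (u (Sum.inl 1)) (u (Sum.inl 2))) U
  g₂_ne : ∀ u ∈ U, g₂ (u (Sum.inl 1)) (u (Sum.inl 2)) ≠ 0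
  g₃_ne : ∀ u ∈ U, g₃ (u (Sum.inl 1)) (u (Sum.inl 2)) ≠ 0

/-- The 4D ansatz, in coordinates `(x², x³, v, y⁵)`: here `Sum.inl 0`, `Sum.inl 1` are the indices
of `x²` and `x³`. -/
structure Ansatz4 (U : Set (Coord 2)) extends AnholonomicData 2 U where
  g₂ : ℝ → ℝ → ℝ
  g₃ : ℝ → ℝ → ℝ
  g₂_smooth : ContDiffOn ℝ 2 (fun u : Coord 2 => g₂ (u (Sum.inl 0)) (u (Sum.inl 1))) U
  g₃_smooth : ContDiffOn ℝ 2 (fun u : Coord 2 => g₃ (u (Sum.inl 0)) (u (Sum.inl 1))) U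
  g₂_ne : ∀ u ∈ U, g₂ (u (Sum.inl 0)) (u (Sum.inl 1)) ≠ 0
  g₃_ne : ∀ u ∈ U, g₃ (u (Sum.inl 0)) (u (Sum.inl 1)) ≠ 0

/-- A conformal factor `Ω(x, v)` and second-order anisotropy coefficients `ζ_i(x, v)`. -/
structure ConformalData (n : ℕ) (U : Set (Coord n)) where
  Ω : (Fin n → ℝ) → ℝ → ℝ
  ζ : Fin n → (Fin n → ℝ) → ℝ → ℝ
  Ω_smooth : ContDiffOn ℝ 2 (liftXV Ω) U
  ζ_smooth : ∀ i, ContDiffOn ℝ 2 (liftXV (ζ i)) U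
  Ω_ne : ∀ u ∈ U, liftXV Ω u ≠ 0

/-- The N-coefficients `N_i^4 = w_i`, `N_i^5 = n_i`. -/
def AnholonomicData.ncoeff {n : ℕ} {U : Set (Coord n)} (A : AnholonomicData n U) : NCoeff n :=
  ![fun i => liftXV (A.w i), fun i => liftXV (A.nn i)]

/-- The N-coefficients `N_i^4 = w_i + ζ_i`, `N_i^5 = n_i`. -/
def AnholonomicData.ncoeffConf {n : ℕ} {U : Set (Coord n)} (A : AnholonomicData n U)
    (C : ConformalData n U) : NCoeff n :=
  ![fun i u => liftXV (A.w i) u + liftXV (C.ζ i) u, fun i => liftXV (A.nn i)]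

/-- The ansatz metric with horizontal coefficients `g`. -/
def AnholonomicData.metric {n : ℕ} {U : Set (Coord n)} (A : AnholonomicData n U)
    (g : Fin n → Coord n → ℝ) : MetricField n :=
  ansatzMatrix g (liftXV A.h₄) (liftXV A.h₅) (fun i => liftXV (A.w i)) (fun i => liftXV (A.nn i))

/-- The conformal ansatz metric
`Ω² [g_i (dx^i)² + h₄ (dv + (w_i + ζ_i) dx^i)² + h₅ (dy⁵ + n_i dx^i)²]`. -/
def AnholonomicData.metricConf {n : ℕ} {U : Set (Coord n)} (A : AnholonomicData n U)
    (g : Fin n → Coord n → ℝ) (C : ConformalData n U) : MetricField n := fun u =>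
  (liftXV C.Ω u) ^ 2 • ansatzMatrix g (liftXV A.h₄) (liftXV A.h₅)
    (fun i x => liftXV (A.w i) x + liftXV (C.ζ i) x) (fun i => liftXV (A.nn i)) u

/-- Horizontal coefficients `(g₁, g₂(x², x³), g₃(x², x³))`. -/
def Ansatz5.hcoeff {U : Set (Coord 3)} (A : Ansatz5 U) : Fin 3 → Coord 3 → ℝ :=
  ![fun _ => A.g₁, fun u => A.g₂ (u (Sum.inl 1)) (u (Sum.inl 2)),
    fun u => A.g₃ (u (Sum.inl 1)) (u (Sum.inl 2))]

/-- Horizontal coefficients `(g₂(x², x³), g₃(x², x³))`. -/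
def Ansatz4.hcoeff {U : Set (Coord 2)} (A : Ansatz4 U) : Fin 2 → Coord 2 → ℝ :=
  ![fun u => A.g₂ (u (Sum.inl 0)) (u (Sum.inl 1)), fun u => A.g₃ (u (Sum.inl 0)) (u (Sum.inl 1))]

/-- The equations `∂_i Ω - (w_i + ζ_i) Ω^* = 0` on `U`. -/
def ConfEq {n : ℕ} {U : Set (Coord n)} (A : AnholonomicData n U) (C : ConformalData n U) : Prop :=
  ∀ u ∈ U, ∀ i : Fin n,
    pd (Sum.inl i) (liftXV C.Ω) u
      - (liftXV (A.w i) u + liftXV (C.ζ i) u) * pd (Sum.inr 0) (liftXV C.Ω) u = 0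

/-! ### Sources -/

/-- The compatibility conditions `Υ¹₁ = Υ²₂ + Υ⁴₄`, `Υ²₂ = Υ³₃`, `Υ⁴₄ = Υ⁵₅`. -/
def Compatible5 (Υ : Matrix (Idx 3) (Idx 3) ℝ) : Prop :=
  Υ (Sum.inl 0) (Sum.inl 0) = Υ (Sum.inl 1) (Sum.inl 1) + Υ (Sum.inr 0) (Sum.inr 0) ∧
  Υ (Sum.inl 1) (Sum.inl 1) = Υ (Sum.inl 2) (Sum.inl 2) ∧
  Υ (Sum.inr 0) (Sum.inr 0) = Υ (Sum.inr 1) (Sum.inr 1)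

/-- The 4D compatibility conditions `Υ²₂ = Υ³₃`, `Υ⁴₄ = Υ⁵₅`. -/
def Compatible4 (Υ : Matrix (Idx 2) (Idx 2) ℝ) : Prop :=
  Υ (Sum.inl 0) (Sum.inl 0) = Υ (Sum.inl 1) (Sum.inl 1) ∧
  Υ (Sum.inr 0) (Sum.inr 0) = Υ (Sum.inr 1) (Sum.inr 1)

/-- The diagonal 5D source `κ Υ^α_β = diag(2Λ, Λ, Λ, Λ, Λ)`. -/
def source5 (κ Λ : ℝ) : Matrix (Idx 3) (Idx 3) ℝ :=
  κ⁻¹ • Matrix.diagonal (Sum.elim ![2 * Λ, Λ, Λ] ![Λ, Λ])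

/-- The isotropic 4D source `κ Υ^α_β = Λ δ^α_β`. -/
def source4 (κ Λ : ℝ) : Matrix (Idx 2) (Idx 2) ℝ :=
  κ⁻¹ • Matrix.diagonal (fun _ => Λ)

end

/-! In the N-elongated frame the metric is diagonal, with horizontal entries `Ω² g_i` and vertical
entries `h_a` that absorb `Ω²`. Since `g_i` ignores the vertical coordinates and `δ_i Ω = 0`, three
families of connection coefficients are explicit: `L^i_{jk}` are the Christoffel symbols of `g` (the
factor `Ω²` cancels), `C^i_{jc} = δ^i_j ∂_c log |Ω|`, and `C^a_{bc}` are the Christoffel symbols of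
the vertical metric with `x` as parameters. The coefficients `L^a_{bk}` enter only `R_{ai}`, which
stays as the mixed equations.

The conformal factor and the anholonomy meet in one expression, the commutator `[δ_α, δ_β]` applied
to `log |Ω|`. It vanishes for two horizontal directions, and for one vertical direction it cancels
`δ_i ∂_c log |Ω|`. So `R_{ij}` is the Ricci tensor of `g`, `R_{ic} = 0`, and `R_{ab}` is the Ricci
tensor of the vertical metric (`ricci_inl_inl`, `ricci_inl_inr`, `ricci_inr_inr`).

A two-dimensional Ricci tensor is a multiple of the metric (`diagRicci_fin_two`), and in 5D the `x¹`
direction is flat. Hence the mixed Ricci diagonal is `(0, P, P, S, S)` in 5D and `(P, P, S, S)` in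
4D, so `R = 2(P + S)`. The diagonal equations become `-S = Λ` and `-P = Λ`, and in 5D also their sum
`-(P + S) = 2Λ`. The metric without conformal factor is the case `Ω = 1`, `ζ = 0`. -/

open Filter Topology

/-! ### Christoffel symbols and Ricci tensor of a diagonal metric. -/

section DiagonalMetric

variable {E : Type*} [NormedAddCommGroup E] [NormedSpace ℝ E] {ι : Type*} [DecidableEq ι]

/-- A function invariant under translations along `e` has vanishing derivative along `e`. -/
theorem fderiv_apply_eq_zero_of_translation_invariant {f : E → ℝ} {e : E}
    (hf : ∀ (x : E) (t : ℝ), f (x + t • e) = f x) (x : E) : fderiv ℝ f x e = 0 := by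
  by_cases hd : DifferentiableAt ℝ f x
  · rw [← hd.lineDeriv_eq_fderiv]
    simp [lineDeriv, hf]
  -- The default value `0` of `fderiv` makes any smoothness hypothesis unnecessary.
  · simp [fderiv_zero_of_not_differentiableAt hd]

theorem fderiv_translation_invariant {f : E → ℝ} {e : E}
    (hf : ∀ (x : E) (t : ℝ), f (x + t • e) = f x) (x : E) (t : ℝ) :
    fderiv ℝ f (x + t • e) = fderiv ℝ f x := by
  rw [← fderiv_comp_add_right]
  simp [hf]

/-- Christoffel symbols `Γ^i_{jk}` of the diagonal metric `g` along the constant vectors `e`. -/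
noncomputable def diagChristoffel (e : ι → E) (g : ι → E → ℝ) (i j k : ι) (x : E) : ℝ :=
  (1 / 2) * ((g i x)⁻¹ * ((1 : Matrix ι ι ℝ) i j * fderiv ℝ (g i) x (e k)
    + (1 : Matrix ι ι ℝ) i k * fderiv ℝ (g i) x (e j)
    - (1 : Matrix ι ι ℝ) j k * fderiv ℝ (g j) x (e i)))

/-- The Ricci tensor of the diagonal metric `g` along the constant vectors `e`. -/
noncomputable def diagRicci [Fintype ι] (e : ι → E) (g : ι → E → ℝ) (i j : ι) (x : E) : ℝ :=
  ∑ k, (fderiv ℝ (diagChristoffel e g k i j) x (e k)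
    - fderiv ℝ (diagChristoffel e g k i k) x (e j)
    + ∑ m, (diagChristoffel e g m i j x * diagChristoffel e g k m k x
      - diagChristoffel e g m i k x * diagChristoffel e g k m j x))

theorem ContDiffAt.differentiableAt_fderiv_apply {f : E → ℝ} {x : E} (hf : ContDiffAt ℝ 2 f x)
    (e : E) : DifferentiableAt ℝ (fun y => fderiv ℝ f y e) x :=
  (((hf.fderiv_right (m := 1) (by norm_num)).differentiableAt (by norm_num)).clm_apply
    (differentiableAt_const e))

theorem ContDiffAt.fderiv_fderiv_apply_comm {f : E → ℝ} {x : E} (hf : ContDiffAt ℝ 2 f x)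
    (e e' : E) :
    fderiv ℝ (fun y => fderiv ℝ f y e) x e' = fderiv ℝ (fun y => fderiv ℝ f y e') x e := by
  have hd := (hf.fderiv_right (m := 1) (by norm_num)).differentiableAt (by norm_num)
  rw [fderiv_clm_apply hd (differentiableAt_const e), fderiv_clm_apply hd (differentiableAt_const e')]
  simpa using (hf.isSymmSndFDerivAt (by simp)).eq e' e

theorem fderiv_diagChristoffel {e : ι → E} {g : ι → E → ℝ} {x : E}
    (hg : ∀ i, ContDiffAt ℝ 2 (g i) x) (hg0 : ∀ i, g i x ≠ 0) (i j k : ι) (v : E) :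
    fderiv ℝ (diagChristoffel e g i j k) x v =
      (1 / 2) * ((g i x)⁻¹ *
        ((1 : Matrix ι ι ℝ) i j * fderiv ℝ (fun y => fderiv ℝ (g i) y (e k)) x v
          + (1 : Matrix ι ι ℝ) i k * fderiv ℝ (fun y => fderiv ℝ (g i) y (e j)) x v
          - (1 : Matrix ι ι ℝ) j k * fderiv ℝ (fun y => fderiv ℝ (g j) y (e i)) x v)
        - ((g i x) ^ 2)⁻¹ * fderiv ℝ (g i) x v *
          ((1 : Matrix ι ι ℝ) i j * fderiv ℝ (g i) x (e k)
            + (1 : Matrix ι ι ℝ) i k * fderiv ℝ (g i) x (e j)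
            - (1 : Matrix ι ι ℝ) j k * fderiv ℝ (g j) x (e i))) := by
  have h1 := ((hg i).differentiableAt_fderiv_apply (e k)).hasFDerivAt
  have h2 := ((hg i).differentiableAt_fderiv_apply (e j)).hasFDerivAt
  have h3 := ((hg j).differentiableAt_fderiv_apply (e i)).hasFDerivAt
  have h0 := ((hg i).differentiableAt (by norm_num)).hasFDerivAt
  have hinv := (hasDerivAt_inv (hg0 i)).comp_hasFDerivAt x h0
  have := (hinv.mul (((h1.const_mul ((1 : Matrix ι ι ℝ) i j)).add
    (h2.const_mul ((1 : Matrix ι ι ℝ) i k))).sub (h3.const_mul ((1 : Matrix ι ι ℝ) j k)))).const_mul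
      (1 / 2)
  have h' : HasFDerivAt (diagChristoffel e g i j k) _ x := this
  rw [h'.fderiv]
  simp
  ring

/-- In dimension two the Ricci tensor is the Gaussian curvature times the metric. Here this is a
direct expansion in which only the symmetry of second derivatives is needed. The space `E` may be
larger than the span of `e`: the other coordinates are parameters. -/
theorem diagRicci_fin_two {e : Fin 2 → E} {g : Fin 2 → E → ℝ} {x : E}
    (hg : ∀ i, ContDiffAt ℝ 2 (g i) x) (hg0 : ∀ i, g i x ≠ 0) :
    (∀ i j, i ≠ j → diagRicci e g i j x = 0) ∧
      (g 0 x)⁻¹ * diagRicci e g 0 0 x = (g 1 x)⁻¹ * diagRicci e g 1 1 x := by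
  have hs := fun i => (hg i).fderiv_fderiv_apply_comm (e 0) (e 1)
  have ha := hg0 0
  have hb := hg0 1
  refine ⟨Fin.forall_fin_two.2 ⟨Fin.forall_fin_two.2 ⟨fun h => absurd rfl h, fun _ => ?_⟩,
    Fin.forall_fin_two.2 ⟨fun _ => ?_, fun h => absurd rfl h⟩⟩, ?_⟩
  all_goals
    simp only [diagRicci, fderiv_diagChristoffel hg hg0, Fin.sum_univ_two, diagChristoffel]
    simp [hs]
    field_simp
    ring

theorem diagChristoffel_succ {n : ℕ} (e : Fin (n + 1) → E) (g : Fin (n + 1) → E → ℝ) (i j k : Fin n) :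
    diagChristoffel e g i.succ j.succ k.succ =
      diagChristoffel (fun i => e i.succ) (fun i => g i.succ) i j k := by
  funext x
  simp [diagChristoffel, Matrix.one_apply]

/-- A flat direction contributes nothing to the Christoffel symbols. -/
theorem diagChristoffel_eq_zero_of_zero {n : ℕ} {e : Fin (n + 1) → E} {g : Fin (n + 1) → E → ℝ}
    (h0 : ∀ x, fderiv ℝ (g 0) x = 0) (he : ∀ i x, fderiv ℝ (g i) x (e 0) = 0)
    {i j k : Fin (n + 1)} (h : i = 0 ∨ j = 0 ∨ k = 0) : diagChristoffel e g i j k = fun _ => 0 := by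
  funext x
  rcases h with rfl | rfl | rfl
  · simp [diagChristoffel, h0, he]
  · by_cases hi : i = 0
    · subst hi
      simp [diagChristoffel, h0]
    · simp [diagChristoffel, h0, he, Matrix.one_apply, hi]
  · by_cases hi : i = 0
    · subst hi
      simp [diagChristoffel, h0, he]
    · by_cases hj : j = 0
      · subst hj
        simp [diagChristoffel, h0, he]
      · simp [diagChristoffel, he, Matrix.one_apply, hi, hj]

theorem diagRicci_succ {n : ℕ} {e : Fin (n + 1) → E} {g : Fin (n + 1) → E → ℝ}
    (h0 : ∀ x, fderiv ℝ (g 0) x = 0) (he : ∀ i x, fderiv ℝ (g i) x (e 0) = 0) (i j : Fin n) (x : E) :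
    diagRicci e g i.succ j.succ x =
      diagRicci (fun i => e i.succ) (fun i => g i.succ) i j x := by
  have hz := fun i j k => diagChristoffel_eq_zero_of_zero (i := i) (j := j) (k := k) h0 he
  simp [diagRicci, Fin.sum_univ_succ, diagChristoffel_succ, hz 0 _ _ (Or.inl rfl),
    hz _ 0 _ (Or.inr (Or.inl rfl))]

theorem diagChristoffel_translation_invariant {e : ι → E} {g : ι → E → ℝ} {v : E}
    (hv : ∀ i (x : E) (t : ℝ), g i (x + t • v) = g i x) (i j k : ι) (x : E) (t : ℝ) :
    diagChristoffel e g i j k (x + t • v) = diagChristoffel e g i j k x := by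
  simp [diagChristoffel, hv, fun i => fderiv_translation_invariant (hv i)]

theorem diagRicci_eq_zero_of_zero {n : ℕ} {e : Fin (n + 1) → E} {g : Fin (n + 1) → E → ℝ}
    (h0 : ∀ x, fderiv ℝ (g 0) x = 0) (he : ∀ i (x : E) (t : ℝ), g i (x + t • e 0) = g i x)
    {i j : Fin (n + 1)} (h : i = 0 ∨ j = 0) (x : E) : diagRicci e g i j x = 0 := by
  have hz := fun i j k => diagChristoffel_eq_zero_of_zero (i := i) (j := j) (k := k) h0
    fun i => fderiv_apply_eq_zero_of_translation_invariant (he i)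
  rcases h with rfl | rfl
  · simp [diagRicci, hz _ 0 _ (Or.inr (Or.inl rfl))]
  -- With the flat index in second place, the term `∂_0 Γ^k_{ik}` carries no Christoffel symbol with
  -- index `0`; it vanishes because the symbols are themselves invariant along `e 0`.
  · have hd : ∀ k, fderiv ℝ (diagChristoffel e g k i k) x (e 0) = 0 := fun k =>
      fderiv_apply_eq_zero_of_translation_invariant
        (diagChristoffel_translation_invariant he k i k) x
    simp [diagRicci, hz _ _ 0 (Or.inr (Or.inr rfl)), hd]

end DiagonalMetric

theorem Matrix.inv_diagonal_of_ne_zero {ι : Type*} [Fintype ι] [DecidableEq ι] {d : ι → ℝ}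
    (hd : ∀ i, d i ≠ 0) : (Matrix.diagonal d)⁻¹ = Matrix.diagonal fun i => (d i)⁻¹ := by
  refine Matrix.inv_eq_right_inv ?_
  simp [Matrix.diagonal_mul_diagonal, hd]

/-- A metric that is diagonal in the N-elongated frame, with horizontal part `Ω² g_i` and vertical
part `h_a`, where `g` does not depend on the vertical coordinates and `δ_i Ω = 0`. -/
structure IsConformallyDiagonal {n : ℕ} (G : MetricField n) (N : NCoeff n) (U : Set (Coord n))
    (g : Fin n → Coord n → ℝ) (h : Fin 2 → Coord n → ℝ) (Ω : Coord n → ℝ) : Prop where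
  isOpen : IsOpen U
  frameMetric_eq : ∀ u, frameMetric G N u =
    Matrix.diagonal (Sum.elim (fun i => Ω u ^ 2 * g i u) (fun a => h a u))
  g_smooth : ∀ i, ContDiffOn ℝ 2 (g i) U
  g_ne : ∀ i, ∀ u ∈ U, g i u ≠ 0
  g_vert : ∀ i a (u : Coord n) (t : ℝ), g i (u + t • Pi.single (Sum.inr a) 1) = g i u
  h_smooth : ∀ a, ContDiffOn ℝ 2 (h a) U
  h_ne : ∀ a, ∀ u ∈ U, h a u ≠ 0
  N_smooth : ∀ a i, ContDiffOn ℝ 2 (N a i) U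
  Ω_smooth : ContDiffOn ℝ 2 Ω U
  Ω_ne : ∀ u ∈ U, Ω u ≠ 0
  elong_Ω : ∀ u ∈ U, ∀ i, elong N (Sum.inl i) Ω u = 0

/-! ### The N-elongated frame, its brackets and its derivatives. -/

section Frame

variable {n : ℕ} {N : NCoeff n}

theorem frame_inl_apply_inl (i m : Fin n) (u : Coord n) :
    frame N (Sum.inl i) u (Sum.inl m) = (1 : Matrix (Fin n) (Fin n) ℝ) m i := by
  simp [frame, Matrix.one_apply, Pi.single_apply]

theorem frame_inl_apply_inr (i : Fin n) (a : Fin 2) (u : Coord n) :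
    frame N (Sum.inl i) u (Sum.inr a) = - N a i u := by
  fin_cases a <;> simp [frame]

theorem differentiableAt_frame {u : Coord n} (hN : ∀ a i, DifferentiableAt ℝ (N a i) u)
    (α : Idx n) : DifferentiableAt ℝ (frame N α) u := by
  rcases α with i | a
  · rw [differentiableAt_pi]
    rintro (m | a)
    · simp [frame_inl_apply_inl]
    · simpa [frame_inl_apply_inr] using hN a i
  · exact differentiableAt_const _

theorem frame_apply_inl_const (α : Idx n) (m : Fin n) (x y : Coord n) :
    frame N α x (Sum.inl m) = frame N α y (Sum.inl m) := by
  rcases α with i | a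
  · simp [frame_inl_apply_inl]
  · rfl

/-- The horizontal components of the frame fields are constant, so brackets are vertical. -/
theorem lieBracket_frame_inl {u : Coord n} (hN : ∀ a i, DifferentiableAt ℝ (N a i) u)
    (α β : Idx n) (m : Fin n) :
    VectorField.lieBracket ℝ (frame N α) (frame N β) u (Sum.inl m) = 0 := by
  have key : ∀ (γ : Idx n) (v : Coord n), fderiv ℝ (frame N γ) u v (Sum.inl m) = 0 := by
    intro γ v
    have h := (hasFDerivAt_pi'.1 (differentiableAt_frame hN γ).hasFDerivAt (Sum.inl m)).fderiv
    have hc : (fun x => frame N γ x (Sum.inl m)) = fun _ => frame N γ u (Sum.inl m) :=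
      funext fun x => frame_apply_inl_const γ m x u
    rw [hc] at h
    have := DFunLike.congr_fun h v
    simpa using this.symm
  simp [VectorField.lieBracket, key]

theorem anholonomy_inl {u : Coord n} (hN : ∀ a i, DifferentiableAt ℝ (N a i) u)
    (m : Fin n) (α β : Idx n) : anholonomy N (Sum.inl m) α β u = 0 :=
  lieBracket_frame_inl hN α β m

theorem anholonomy_inr_inr (γ : Idx n) (a b : Fin 2) (u : Coord n) :
    anholonomy N γ (Sum.inr a) (Sum.inr b) u = 0 := by
  have : VectorField.lieBracket ℝ (frame N (Sum.inr a)) (frame N (Sum.inr b)) u = 0 := by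
    have hc : ∀ c : Fin 2, frame N (Sum.inr c) = fun _ => Pi.single (Sum.inr c) 1 := fun c => rfl
    simp [VectorField.lieBracket, hc]
  rcases γ with m | c <;> simp [anholonomy, this, coframe]

/-- The vertical part of the commutator of two frame derivatives. -/
theorem sum_anholonomy_mul_fderiv {u : Coord n} (hN : ∀ a i, DifferentiableAt ℝ (N a i) u)
    {φ : Coord n → ℝ} (hφ : ContDiffAt ℝ 2 φ u) (α β : Idx n) :
    ∑ a : Fin 2, fderiv ℝ φ u (Pi.single (Sum.inr a) 1) * anholonomy N (Sum.inr a) α β u =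
      elong N α (elong N β φ) u - elong N β (elong N α φ) u := by
  have hd := (hφ.fderiv_right (m := 1) (by norm_num)).differentiableAt (by norm_num)
  have hB := lieBracket_frame_inl hN α β
  set B := VectorField.lieBracket ℝ (frame N α) (frame N β) u with hBdef
  have hsum : B = ∑ a : Fin 2, anholonomy N (Sum.inr a) α β u • Pi.single (Sum.inr a) (1 : ℝ) := by
    funext γ
    rcases γ with m | c
    · simp [hB]
    · simp [anholonomy, coframe, ← hBdef, hB, Pi.single_apply]
  have hfd : ∀ γ δ : Idx n, elong N γ (elong N δ φ) u =
      fderiv ℝ (fderiv ℝ φ) u (frame N γ u) (frame N δ u)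
        + fderiv ℝ φ u (fderiv ℝ (frame N δ) u (frame N γ u)) := by
    intro γ δ
    have : elong N δ φ = fun x => fderiv ℝ φ x (frame N δ x) := rfl
    rw [this, elong, fderiv_clm_apply hd (differentiableAt_frame hN δ)]
    simp [add_comm]
  -- The second-derivative terms cancel by symmetry; what remains is `dφ` applied to the bracket.
  have hB' : fderiv ℝ φ u B = elong N α (elong N β φ) u - elong N β (elong N α φ) u := by
    rw [hfd, hfd, (hφ.isSymmSndFDerivAt (by simp)).eq (frame N α u), hBdef, VectorField.lieBracket,
      map_sub]
    ring
  rw [← hB', hsum, map_sum]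
  simp [mul_comm]

theorem elong_congr {f f' : Coord n → ℝ} {u : Coord n} (α : Idx n) (h : f =ᶠ[𝓝 u] f') :
    elong N α f u = elong N α f' u := by
  rw [elong, elong, h.fderiv_eq]

theorem elong_inl (i : Fin n) (f : Coord n → ℝ) (u : Coord n) :
    elong N (Sum.inl i) f u = fderiv ℝ f u (Pi.single (Sum.inl i) 1)
      - ∑ a : Fin 2, N a i u * fderiv ℝ f u (Pi.single (Sum.inr a) 1) := by
  simp [elong, frame]

theorem elong_inl_of_vertical_invariant {f : Coord n → ℝ}
    (hf : ∀ a (u : Coord n) (t : ℝ), f (u + t • Pi.single (Sum.inr a) 1) = f u) (i : Fin n)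
    (u : Coord n) : elong N (Sum.inl i) f u = fderiv ℝ f u (Pi.single (Sum.inl i) 1) := by
  simp [elong_inl, fun a => fderiv_apply_eq_zero_of_translation_invariant (hf a)]

end Frame

/-! ### Connection coefficients and Ricci blocks of a conformally diagonal metric. -/

namespace IsConformallyDiagonal

variable {n : ℕ} {G : MetricField n} {N : NCoeff n} {U : Set (Coord n)}
  {g : Fin n → Coord n → ℝ} {h : Fin 2 → Coord n → ℝ} {Ω : Coord n → ℝ}

theorem hBlock_eq (H : IsConformallyDiagonal G N U g h Ω) (u : Coord n) :
    hBlock G N u = Matrix.diagonal fun i => Ω u ^ 2 * g i u := by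
  ext i j
  simp [hBlock, H.frameMetric_eq, Matrix.toBlocks₁₁, Matrix.diagonal_apply]

theorem vBlock_eq (H : IsConformallyDiagonal G N U g h Ω) (u : Coord n) :
    vBlock G N u = Matrix.diagonal fun a => h a u := by
  ext i j
  simp [vBlock, H.frameMetric_eq, Matrix.toBlocks₂₂, Matrix.diagonal_apply]

theorem N_differentiableAt (H : IsConformallyDiagonal G N U g h Ω) {u : Coord n} (hu : u ∈ U)
    (a : Fin 2) (i : Fin n) : DifferentiableAt ℝ (N a i) u :=
  ((H.N_smooth a i).contDiffAt (H.isOpen.mem_nhds hu)).differentiableAt (by norm_num)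

/-- `Real.log` is `log |·|`, so `Ω ≠ 0` suffices and its sign is free. -/
theorem log_contDiffAt (H : IsConformallyDiagonal G N U g h Ω) {u : Coord n} (hu : u ∈ U) :
    ContDiffAt ℝ 2 (fun x => Real.log (Ω x)) u :=
  (H.Ω_smooth.contDiffAt (H.isOpen.mem_nhds hu)).log (H.Ω_ne u hu)

theorem fderiv_log (H : IsConformallyDiagonal G N U g h Ω) {u : Coord n} (hu : u ∈ U) :
    fderiv ℝ (fun x => Real.log (Ω x)) u = (Ω u)⁻¹ • fderiv ℝ Ω u :=
  fderiv.log ((H.Ω_smooth.contDiffAt (H.isOpen.mem_nhds hu)).differentiableAt (by norm_num))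
    (H.Ω_ne u hu)

theorem elong_log (H : IsConformallyDiagonal G N U g h Ω) {u : Coord n} (hu : u ∈ U) (i : Fin n) :
    elong N (Sum.inl i) (fun x => Real.log (Ω x)) u = 0 := by
  have := H.elong_Ω u hu i
  rw [elong] at this ⊢
  simp [H.fderiv_log hu, this]

theorem fderiv_hBlock (H : IsConformallyDiagonal G N U g h Ω) {u : Coord n} (hu : u ∈ U)
    (i j : Fin n) (v : Coord n) :
    fderiv ℝ (fun x => hBlock G N x i j) u v = (1 : Matrix (Fin n) (Fin n) ℝ) i j *
      (Ω u ^ 2 * fderiv ℝ (g i) u v + 2 * Ω u * g i u * fderiv ℝ Ω u v) := by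
  by_cases hij : i = j
  · subst hij
    have hg := ((H.g_smooth i).contDiffAt (H.isOpen.mem_nhds hu)).differentiableAt (by norm_num)
    have hΩ := (H.Ω_smooth.contDiffAt (H.isOpen.mem_nhds hu)).differentiableAt (by norm_num)
    have := ((hΩ.hasFDerivAt.pow 2).mul hg.hasFDerivAt).fderiv
    simp only [H.hBlock_eq, Matrix.diagonal_apply_eq]
    erw [this]
    simp
    ring
  · simp [H.hBlock_eq, hij]

theorem fderiv_vBlock (H : IsConformallyDiagonal G N U g h Ω) (u : Coord n)
    (a b : Fin 2) (v : Coord n) :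
    fderiv ℝ (fun x => vBlock G N x a b) u v = (1 : Matrix (Fin 2) (Fin 2) ℝ) a b *
      fderiv ℝ (h a) u v := by
  by_cases hab : a = b
  · subst hab
    simp [H.vBlock_eq]
  · simp [H.vBlock_eq, hab]

theorem hBlock_inv (H : IsConformallyDiagonal G N U g h Ω) {u : Coord n} (hu : u ∈ U) :
    (hBlock G N u)⁻¹ = Matrix.diagonal fun i => (Ω u ^ 2 * g i u)⁻¹ := by
  rw [H.hBlock_eq, Matrix.inv_diagonal_of_ne_zero]
  exact fun i => mul_ne_zero (pow_ne_zero _ (H.Ω_ne u hu)) (H.g_ne i u hu)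

theorem vBlock_inv (H : IsConformallyDiagonal G N U g h Ω) {u : Coord n} (hu : u ∈ U) :
    (vBlock G N u)⁻¹ = Matrix.diagonal fun a => (h a u)⁻¹ := by
  rw [H.vBlock_eq, Matrix.inv_diagonal_of_ne_zero]
  exact fun a => H.h_ne a u hu

theorem elong_hBlock (H : IsConformallyDiagonal G N U g h Ω) {u : Coord n} (hu : u ∈ U)
    (i j k : Fin n) :
    elong N (Sum.inl k) (fun x => hBlock G N x i j) u = (1 : Matrix (Fin n) (Fin n) ℝ) i j *
      (Ω u ^ 2 * fderiv ℝ (g i) u (Pi.single (Sum.inl k) 1)) := by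
  have h1 : fderiv ℝ Ω u (frame N (Sum.inl k) u) = 0 := H.elong_Ω u hu k
  have h2 : fderiv ℝ (g i) u (frame N (Sum.inl k) u) = fderiv ℝ (g i) u (Pi.single (Sum.inl k) 1) :=
    elong_inl_of_vertical_invariant (H.g_vert i) k u
  rw [elong, H.fderiv_hBlock hu, h1, h2]
  ring

/-- As `δ_k Ω = 0`, the factor `Ω²` passes through `δ_k` and cancels against the inverse metric. -/
theorem canonicalConnection_hhh (H : IsConformallyDiagonal G N U g h Ω) {u : Coord n} (hu : u ∈ U)
    (i j k : Fin n) :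
    canonicalConnection G N (Sum.inl i) (Sum.inl j) (Sum.inl k) u =
      diagChristoffel (fun i => Pi.single (Sum.inl i) 1) g i j k u := by
  have h1 := H.Ω_ne u hu
  have h2 := H.g_ne i u hu
  simp only [canonicalConnection, H.hBlock_inv hu, H.elong_hBlock hu, Matrix.diagonal_apply,
    ite_mul, zero_mul, Finset.sum_ite_eq, Finset.mem_univ, if_true, diagChristoffel]
  field_simp

/-- A vertical derivative sees only `Ω²`, and `½ Ω⁻² ∂_c Ω² = ∂_c log |Ω|`. Writing it as the
gradient of a scalar lets the commutator formula apply. -/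
theorem canonicalConnection_hhv (H : IsConformallyDiagonal G N U g h Ω) {u : Coord n} (hu : u ∈ U)
    (i j : Fin n) (c : Fin 2) :
    canonicalConnection G N (Sum.inl i) (Sum.inl j) (Sum.inr c) u =
      (1 : Matrix (Fin n) (Fin n) ℝ) i j *
        fderiv ℝ (fun x => Real.log (Ω x)) u (Pi.single (Sum.inr c) 1) := by
  have h1 := H.Ω_ne u hu
  have h2 := H.g_ne j u hu
  simp only [canonicalConnection, H.hBlock_inv hu, pd, H.fderiv_hBlock hu, Matrix.diagonal_apply,
    ite_mul, zero_mul, Finset.sum_ite_eq, Finset.mem_univ, if_true, H.fderiv_log hu,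
    fderiv_apply_eq_zero_of_translation_invariant (H.g_vert _ c)]
  by_cases hij : i = j
  · subst hij
    simp
    field_simp
  · simp [hij, Ne.symm hij]

theorem canonicalConnection_vvv (H : IsConformallyDiagonal G N U g h Ω) {u : Coord n} (hu : u ∈ U)
    (a b c : Fin 2) :
    canonicalConnection G N (Sum.inr a) (Sum.inr b) (Sum.inr c) u =
      diagChristoffel (fun a => Pi.single (Sum.inr a) 1) h a b c u := by
  simp only [canonicalConnection, H.vBlock_inv hu, pd, H.fderiv_vBlock, Matrix.diagonal_apply,
    ite_mul, zero_mul, Finset.sum_ite_eq, Finset.mem_univ, if_true, diagChristoffel]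

/-- The only term beyond the Ricci tensor of `g` is `Σ_a ∂_a log |Ω| w^a_{ji} = [δ_j, δ_i] log |Ω|`,
which is zero. -/
theorem ricci_inl_inl (H : IsConformallyDiagonal G N U g h Ω) {u : Coord n} (hu : u ∈ U)
    (i j : Fin n) :
    ricci G N (Sum.inl i) (Sum.inl j) u =
      diagRicci (fun i => Pi.single (Sum.inl i) 1) g i j u := by
  have hN := H.N_differentiableAt hu
  have hU := H.isOpen.mem_nhds hu
  -- Vanishing near `u`, not just at `u`, is what permits a second derivative.
  have hlog : ∀ k, elong N (Sum.inl k) (fun x => Real.log (Ω x)) =ᶠ[𝓝 u] fun _ => 0 := fun k =>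
    Filter.mem_of_superset hU fun x hx => H.elong_log hx k
  have hcomm := sum_anholonomy_mul_fderiv hN (H.log_contDiffAt hu) (Sum.inl j) (Sum.inl i)
  rw [elong_congr _ (hlog i), elong_congr _ (hlog j)] at hcomm
  have hder : ∀ k l m p, elong N (Sum.inl p)
      (canonicalConnection G N (Sum.inl k) (Sum.inl l) (Sum.inl m)) u =
      fderiv ℝ (diagChristoffel (fun i => Pi.single (Sum.inl i) 1) g k l m) u
        (Pi.single (Sum.inl p) 1) := by
    intro k l m p
    rw [elong_congr _ (Filter.mem_of_superset hU fun x hx => H.canonicalConnection_hhh hx k l m)]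
    exact elong_inl_of_vertical_invariant
      (fun a => diagChristoffel_translation_invariant (fun i => H.g_vert i a) k l m) p u
  have hz : ∀ a k γ, canonicalConnection G N (Sum.inr a) (Sum.inl k) γ = fun _ => 0 := by
    rintro a k (_ | _) <;> rfl
  simp only [ricci, curvature, Fintype.sum_sum_type, H.canonicalConnection_hhh hu,
    H.canonicalConnection_hhv hu, hder, hz, anholonomy_inl hN]
  simp [diagRicci, Finset.sum_add_distrib, Matrix.one_apply, elong] at hcomm ⊢
  exact hcomm

/-- The quadratic terms cancel because `C^i_{jc}` is a multiple of the identity, and `∂_c L^k_{ik} =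
0`. There remains `δ_i ∂_c log |Ω| + [∂_c, δ_i] log |Ω| = ∂_c δ_i log |Ω| = 0`. -/
theorem ricci_inl_inr (H : IsConformallyDiagonal G N U g h Ω) {u : Coord n} (hu : u ∈ U)
    (i : Fin n) (c : Fin 2) : ricci G N (Sum.inl i) (Sum.inr c) u = 0 := by
  have hN := H.N_differentiableAt hu
  have hU := H.isOpen.mem_nhds hu
  have hlog : ∀ k, elong N (Sum.inl k) (fun x => Real.log (Ω x)) =ᶠ[𝓝 u] fun _ => 0 := fun k =>
    Filter.mem_of_superset hU fun x hx => H.elong_log hx k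
  have hcomm := sum_anholonomy_mul_fderiv hN (H.log_contDiffAt hu) (Sum.inr c) (Sum.inl i)
  rw [elong_congr _ (hlog i)] at hcomm
  have hder : ∀ k l m, elong N (Sum.inr c)
      (canonicalConnection G N (Sum.inl k) (Sum.inl l) (Sum.inl m)) u = 0 := by
    intro k l m
    rw [elong_congr _ (Filter.mem_of_superset hU fun x hx => H.canonicalConnection_hhh hx k l m)]
    exact fderiv_apply_eq_zero_of_translation_invariant
      (diagChristoffel_translation_invariant (fun i => H.g_vert i c) k l m) u
  have hder' : ∀ k l p, elong N (Sum.inl p)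
      (canonicalConnection G N (Sum.inl k) (Sum.inl l) (Sum.inr c)) u =
      (1 : Matrix (Fin n) (Fin n) ℝ) k l *
        elong N (Sum.inl p) (elong N (Sum.inr c) (fun x => Real.log (Ω x))) u := by
    intro k l p
    rw [elong_congr _ (Filter.mem_of_superset hU fun x hx => H.canonicalConnection_hhv hx k l c)]
    rw [elong, fderiv_const_mul ((H.log_contDiffAt hu).differentiableAt_fderiv_apply _)]
    rfl
  have hz : ∀ a k γ, canonicalConnection G N (Sum.inr a) (Sum.inl k) γ = fun _ => 0 := by
    rintro a k (_ | _) <;> rfl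
  have hc0 : elong N (Sum.inr c) (fun _ : Coord n => (0 : ℝ)) u = 0 := by simp [elong]
  rw [hc0] at hcomm
  simp only [ricci, curvature, Fintype.sum_sum_type, H.canonicalConnection_hhh hu,
    H.canonicalConnection_hhv hu, hder, hder', hz, anholonomy_inl hN]
  simp only [Finset.sum_add_distrib, Finset.sum_sub_distrib]
  simp [Matrix.one_apply, elong] at hcomm ⊢
  simp only [← Finset.mul_sum, ← Finset.sum_mul]
  linarith

/-- Vertical frame fields commute and the connection preserves the splitting, so only `C^a_{bc}` and
its vertical derivatives contribute. -/
theorem ricci_inr_inr (H : IsConformallyDiagonal G N U g h Ω) {u : Coord n} (hu : u ∈ U)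
    (a b : Fin 2) :
    ricci G N (Sum.inr a) (Sum.inr b) u =
      diagRicci (fun a => Pi.single (Sum.inr a) 1) h a b u := by
  have hU := H.isOpen.mem_nhds hu
  have hder : ∀ k l m p, elong N (Sum.inr p)
      (canonicalConnection G N (Sum.inr k) (Sum.inr l) (Sum.inr m)) u =
      fderiv ℝ (diagChristoffel (fun a => Pi.single (Sum.inr a) 1) h k l m) u
        (Pi.single (Sum.inr p) 1) := by
    intro k l m p
    rw [elong_congr _ (Filter.mem_of_superset hU fun x hx => H.canonicalConnection_vvv hx k l m)]
    rfl
  have hz : ∀ a k γ, canonicalConnection G N (Sum.inl a) (Sum.inr k) γ = fun _ => 0 := by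
    rintro a k (_ | _) <;> rfl
  simp only [ricci, curvature, Fintype.sum_sum_type, H.canonicalConnection_vvv hu, hder, hz,
    anholonomy_inr_inr]
  simp [diagRicci, elong]

end IsConformallyDiagonal

/-! ### The ansatz is diagonal in its N-elongated frame. -/

section Ansatz

variable {n : ℕ}

/-- The forms `δy^a` annihilate `δ_j`, so lowering its index leaves `g_j dx^j`. -/
theorem ansatzMatrix_mulVec_frame_inl (g : Fin n → Coord n → ℝ) (h₄ h₅ : Coord n → ℝ)
    (w m : Fin n → Coord n → ℝ) (j : Fin n) (u : Coord n) :
    (ansatzMatrix g h₄ h₅ w m u).mulVec (frame ![w, m] (Sum.inl j) u) =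
      Pi.single (Sum.inl j) (g j u) := by
  funext γ
  rcases γ with i | a
  · simp [ansatzMatrix, frame, Matrix.mulVec_sub, Matrix.mulVec_add, Matrix.mulVec_smul,
      Pi.single_apply]
    split_ifs <;> simp_all <;> ring
  · fin_cases a <;>
    · simp [ansatzMatrix, frame, Matrix.mulVec_sub, Matrix.mulVec_add, Matrix.mulVec_smul]

/-- Lowering the index of `∂_a` gives `h_a δy^a`. -/
theorem ansatzMatrix_mulVec_frame_inr (g : Fin n → Coord n → ℝ) (h₄ h₅ : Coord n → ℝ)
    (w m : Fin n → Coord n → ℝ) (a : Fin 2) (u : Coord n) :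
    (ansatzMatrix g h₄ h₅ w m u).mulVec (frame ![w, m] (Sum.inr a) u) =
      Sum.elim (fun i => ![w i u * h₄ u, m i u * h₅ u] a)
        (Pi.single a (![h₄ u, h₅ u] a)) := by
  funext γ
  rcases γ with i | b
  · simp [ansatzMatrix, frame]
  · simp [ansatzMatrix, frame, Matrix.diagonal_apply, Pi.single_apply]
    split_ifs with hb
    · rw [hb]
    · rfl

theorem frameMetric_ansatz (c : Coord n → ℝ) (g : Fin n → Coord n → ℝ) (h₄ h₅ : Coord n → ℝ)
    (w m : Fin n → Coord n → ℝ) (u : Coord n) :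
    frameMetric (fun x => c x • ansatzMatrix g h₄ h₅ w m x) ![w, m] u =
      Matrix.diagonal (Sum.elim (fun i => c u * g i u) (fun a => c u * ![h₄, h₅] a u)) := by
  ext α β
  rw [frameMetric, Matrix.of_apply, Matrix.smul_mulVec, dotProduct_smul]
  rcases β with j | b
  · rw [ansatzMatrix_mulVec_frame_inl]
    rcases α with i | a
    · by_cases hij : i = j
      · subst hij
        simp [frame_inl_apply_inl]
      · simp [frame_inl_apply_inl, hij, Ne.symm hij]
    · simp [frame]
  · rw [ansatzMatrix_mulVec_frame_inr]
    rcases α with i | a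
    · fin_cases b <;>
      simp [dotProduct, Fintype.sum_sum_type, frame_inl_apply_inl, frame_inl_apply_inr,
        Matrix.one_apply]
    · by_cases hab : a = b
      · subst hab
        fin_cases a <;> simp [frame]
      · simp [frame, hab]

theorem liftXV_add_smul_single_inr_one (f : (Fin n → ℝ) → ℝ → ℝ) (u : Coord n) (t : ℝ) :
    liftXV f (u + t • Pi.single (Sum.inr 1) 1) = liftXV f u := by
  simp [liftXV]

theorem AnholonomicData.isConformallyDiagonal {U : Set (Coord n)} (hU : IsOpen U)
    (A : AnholonomicData n U) (C : ConformalData n U) (hC : ConfEq A C) {g : Fin n → Coord n → ℝ}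
    (hg : ∀ i, ContDiffOn ℝ 2 (g i) U) (hg0 : ∀ i, ∀ u ∈ U, g i u ≠ 0)
    (hgv : ∀ i a (u : Coord n) (t : ℝ), g i (u + t • Pi.single (Sum.inr a) 1) = g i u) :
    IsConformallyDiagonal (A.metricConf g C) (A.ncoeffConf C) U g
      (fun a u => liftXV C.Ω u ^ 2 * ![liftXV A.h₄, liftXV A.h₅] a u) (liftXV C.Ω) where
  isOpen := hU
  frameMetric_eq u := frameMetric_ansatz (fun x => liftXV C.Ω x ^ 2) g _ _ _ _ u
  g_smooth := hg
  g_ne := hg0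
  g_vert := hgv
  h_smooth := Fin.forall_fin_two.2
    ⟨(C.Ω_smooth.pow 2).mul A.h₄_smooth, (C.Ω_smooth.pow 2).mul A.h₅_smooth⟩
  h_ne := Fin.forall_fin_two.2
    ⟨fun u hu => mul_ne_zero (pow_ne_zero _ (C.Ω_ne u hu)) (A.h₄_ne u hu),
      fun u hu => mul_ne_zero (pow_ne_zero _ (C.Ω_ne u hu)) (A.h₅_ne u hu)⟩
  N_smooth := Fin.forall_fin_two.2
    ⟨fun i => (A.w_smooth i).add (C.ζ_smooth i), A.nn_smooth⟩
  Ω_smooth := C.Ω_smooth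
  Ω_ne := C.Ω_ne
  elong_Ω u hu i := by
    -- `Ω` does not depend on `y⁵`, so the `n_i` term of `δ_i Ω` drops out and `ConfEq` says exactly
    -- `δ_i Ω = 0`.
    have h5 : fderiv ℝ (liftXV C.Ω) u (Pi.single (Sum.inr 1) 1) = 0 :=
      fderiv_apply_eq_zero_of_translation_invariant (liftXV_add_smul_single_inr_one C.Ω) u
    have := hC u hu i
    simpa [elong_inl, h5, pd, AnholonomicData.ncoeffConf] using this

/-- The trivial conformal data `Ω = 1`, `ζ = 0`. -/
def ConformalData.trivial (n : ℕ) (U : Set (Coord n)) : ConformalData n U where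
  Ω _ _ := 1
  ζ _ _ _ := 0
  Ω_smooth := contDiffOn_const
  ζ_smooth _ := contDiffOn_const
  Ω_ne _ _ := one_ne_zero

theorem AnholonomicData.metricConf_trivial {U : Set (Coord n)} (A : AnholonomicData n U)
    (g : Fin n → Coord n → ℝ) : A.metricConf g (ConformalData.trivial n U) = A.metric g := by
  funext u
  simp [AnholonomicData.metricConf, AnholonomicData.metric, ConformalData.trivial, liftXV]
  rfl

theorem AnholonomicData.ncoeffConf_trivial {U : Set (Coord n)} (A : AnholonomicData n U) :
    A.ncoeffConf (ConformalData.trivial n U) = A.ncoeff := by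
  simp [AnholonomicData.ncoeffConf, AnholonomicData.ncoeff, ConformalData.trivial, liftXV]
  rfl

theorem confEq_trivial {U : Set (Coord n)} (A : AnholonomicData n U) :
    ConfEq A (ConformalData.trivial n U) := by
  intro u _ i
  have : liftXV (ConformalData.trivial n U).Ω = fun _ => (1 : ℝ) := rfl
  simp [this, pd]

end Ansatz

/-! ### Einstein equations for a diagonal metric and source. -/

section Einstein

variable {n : ℕ} {G : MetricField n} {N : NCoeff n} {u : Coord n} {d : Idx n → ℝ}

theorem ricciMixed_of_diagonal (hd : ∀ α, d α ≠ 0) (hF : frameMetric G N u = Matrix.diagonal d)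
    (α β : Idx n) : ricciMixed G N α β u = (d α)⁻¹ * ricci G N α β u := by
  simp only [ricciMixed, hF, Matrix.inv_diagonal_of_ne_zero hd, Matrix.diagonal_apply,
    ite_mul, zero_mul, Finset.sum_ite_eq, Finset.mem_univ, if_true]

theorem scalarCurv_of_diagonal (hd : ∀ α, d α ≠ 0) (hF : frameMetric G N u = Matrix.diagonal d) :
    scalarCurv G N u = ∑ α, ricciMixed G N α α u := by
  simp only [scalarCurv, ricciMixed_of_diagonal hd hF]
  simp only [hF, Matrix.inv_diagonal_of_ne_zero hd, Matrix.diagonal_apply,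
    ite_mul, zero_mul, Finset.sum_ite_eq, Finset.mem_univ, if_true]

/-- For a diagonal metric and source, the Einstein equations split into the diagonal ones and the
vanishing of the off-diagonal Ricci components. -/
theorem einsteinAt_iff_of_diagonal (hd : ∀ α, d α ≠ 0) (hF : frameMetric G N u = Matrix.diagonal d)
    (κ : ℝ) {Υ : Matrix (Idx n) (Idx n) ℝ} (hΥ : ∀ α β, α ≠ β → Υ α β = 0) :
    EinsteinAt G N κ Υ u ↔
      DiagEinsteinAt G N κ Υ u ∧ ∀ α β, α ≠ β → ricci G N α β u = 0 := by
  have hs : ∀ α β, ∑ γ : Idx n, frameMetric G N u α γ * Υ γ β = d α * Υ α β := by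
    intro α β
    simp only [hF, Matrix.diagonal_apply, ite_mul, zero_mul, Finset.sum_ite_eq, Finset.mem_univ,
      if_true]
  have hdiag : ∀ α, ricci G N α α u - (1 / 2) * d α * scalarCurv G N u = κ * (d α * Υ α α) ↔
      ricciMixed G N α α u - (1 / 2) * scalarCurv G N u = κ * Υ α α := by
    intro α
    rw [ricciMixed_of_diagonal hd hF, ← mul_right_inj' (hd α)]
    have := hd α
    field_simp
  constructor
  · intro hE
    refine ⟨fun α => (hdiag α).1 ?_, fun α β hαβ => ?_⟩
    · have := hE α α
      rw [hs] at this
      simpa [hF] using this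
    · have := hE α β
      rw [hs] at this
      simpa [hF, hαβ, hΥ α β hαβ] using this
  · rintro ⟨hD, hO⟩ α β
    rw [hs]
    by_cases hαβ : α = β
    · subst hαβ
      simpa [hF] using (hdiag α).2 (hD α)
    · simp [hF, hαβ, hΥ α β hαβ, hO α β hαβ]

/-- The Ricci tensor of a d-connection need not be symmetric: `R_{ia}` and `R_{ai}` are separate
conditions, and only the latter survives. -/
theorem ricci_offDiag_iff_mixed
    (hh : ∀ i j, i ≠ j → ricci G N (Sum.inl i) (Sum.inl j) u = 0)
    (hv : ∀ i a, ricci G N (Sum.inl i) (Sum.inr a) u = 0)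
    (vv : ∀ a b, a ≠ b → ricci G N (Sum.inr a) (Sum.inr b) u = 0) :
    (∀ α β, α ≠ β → ricci G N α β u = 0) ↔ MixedRicciVanishAt G N u := by
  constructor
  · exact fun H i => ⟨H _ _ (by simp), H _ _ (by simp)⟩
  · rintro H (i | a) (j | b) hne
    · exact hh i j (by simpa using hne)
    · exact hv i b
    · exact Fin.forall_fin_two (p := fun a => ricci G N (Sum.inr a) (Sum.inl j) u = 0) |>.2 (H j) a
    · exact vv a b (by simpa using hne)

end Einstein

/-! ### Reduction of the Einstein equations to two scalar ones. -/

namespace IsConformallyDiagonal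

section

variable {n : ℕ} {G : MetricField n} {N : NCoeff n} {U : Set (Coord n)}
  {g : Fin n → Coord n → ℝ} {h : Fin 2 → Coord n → ℝ} {Ω : Coord n → ℝ}

theorem diag_ne_zero (H : IsConformallyDiagonal G N U g h Ω) {u : Coord n} (hu : u ∈ U)
    (α : Idx n) : Sum.elim (fun i => Ω u ^ 2 * g i u) (fun a => h a u) α ≠ 0 := by
  rcases α with i | a
  · exact mul_ne_zero (pow_ne_zero _ (H.Ω_ne u hu)) (H.g_ne i u hu)
  · exact H.h_ne a u hu

theorem ricciMixed_eq (H : IsConformallyDiagonal G N U g h Ω) {u : Coord n} (hu : u ∈ U)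
    (α β : Idx n) : ricciMixed G N α β u =
      (Sum.elim (fun i => Ω u ^ 2 * g i u) (fun a => h a u) α)⁻¹ * ricci G N α β u :=
  ricciMixed_of_diagonal (H.diag_ne_zero hu) (H.frameMetric_eq u) α β

theorem diagRicci_vertical (H : IsConformallyDiagonal G N U g h Ω) {u : Coord n} (hu : u ∈ U) :
    (∀ a b, a ≠ b → ricci G N (Sum.inr a) (Sum.inr b) u = 0) ∧
      ricciMixed G N (Sum.inr 0) (Sum.inr 0) u = ricciMixed G N (Sum.inr 1) (Sum.inr 1) u := by
  simpa [H.ricciMixed_eq hu, H.ricci_inr_inr hu] using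
    diagRicci_fin_two (e := fun a => (Pi.single (Sum.inr a) 1 : Coord n))
      (fun a => (H.h_smooth a).contDiffAt (H.isOpen.mem_nhds hu)) (fun a => H.h_ne a u hu)

theorem einsteinAt_iff (H : IsConformallyDiagonal G N U g h Ω) {u : Coord n} (hu : u ∈ U)
    (hh : ∀ i j, i ≠ j → ricci G N (Sum.inl i) (Sum.inl j) u = 0)
    (κ : ℝ) {Υ : Matrix (Idx n) (Idx n) ℝ} (hΥ : ∀ α β, α ≠ β → Υ α β = 0) :
    EinsteinAt G N κ Υ u ↔ DiagEinsteinAt G N κ Υ u ∧ MixedRicciVanishAt G N u := by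
  rw [einsteinAt_iff_of_diagonal (H.diag_ne_zero hu) (H.frameMetric_eq u) κ hΥ,
    ricci_offDiag_iff_mixed hh (H.ricci_inl_inr hu) (H.diagRicci_vertical hu).1]

end

theorem diagEinsteinAt_source4_iff {G : MetricField 2} {N : NCoeff 2} {U : Set (Coord 2)}
    {g h : Fin 2 → Coord 2 → ℝ} {Ω : Coord 2 → ℝ} (H : IsConformallyDiagonal G N U g h Ω)
    {u : Coord 2} (hu : u ∈ U) {κ : ℝ} (hκ : κ ≠ 0) (Λ : ℝ) :
    (DiagEinsteinAt G N κ (source4 κ Λ) u ↔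
      ricciMixed G N (Sum.inl 0) (Sum.inl 0) u = -Λ ∧
        ricciMixed G N (Sum.inr 0) (Sum.inr 0) u = -Λ) ∧
    (EinsteinAt G N κ (source4 κ Λ) u ↔
      (ricciMixed G N (Sum.inl 0) (Sum.inl 0) u = -Λ ∧
        ricciMixed G N (Sum.inr 0) (Sum.inr 0) u = -Λ) ∧ MixedRicciVanishAt G N u) := by
  obtain ⟨hoff, hdiag⟩ := diagRicci_fin_two (e := fun i => (Pi.single (Sum.inl i) 1 : Coord 2))
    (fun i => (H.g_smooth i).contDiffAt (H.isOpen.mem_nhds hu)) (fun i => H.g_ne i u hu)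
  have hvert := (H.diagRicci_vertical hu).2
  have hhor : ricciMixed G N (Sum.inl 0) (Sum.inl 0) u =
      ricciMixed G N (Sum.inl 1) (Sum.inl 1) u := by
    simp only [H.ricciMixed_eq hu, H.ricci_inl_inl hu, Sum.elim_inl, mul_inv, mul_assoc, hdiag]
  have hD : DiagEinsteinAt G N κ (source4 κ Λ) u ↔
      ricciMixed G N (Sum.inl 0) (Sum.inl 0) u = -Λ ∧
        ricciMixed G N (Sum.inr 0) (Sum.inr 0) u = -Λ := by
    simp only [DiagEinsteinAt, Sum.forall, Fin.forall_fin_two, source4, Matrix.smul_apply,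
      Matrix.diagonal_apply_eq, smul_eq_mul, mul_inv_cancel_left₀ hκ,
      scalarCurv_of_diagonal (H.diag_ne_zero hu) (H.frameMetric_eq u), Fintype.sum_sum_type,
      Fin.sum_univ_two, ← hhor, ← hvert]
    constructor
    -- With `R = 2(P + S)`, the horizontal equation fixes the vertical value `S`, and the vertical
    -- equation fixes `P`.
    · rintro ⟨⟨h1, -⟩, h2, -⟩
      constructor <;> linarith
    · rintro ⟨h1, h2⟩
      simp only [h1, h2]
      ring_nf
      simp
  refine ⟨hD, ?_⟩
  rw [H.einsteinAt_iff hu (fun i j hij => by rw [H.ricci_inl_inl hu, hoff i j hij]) κ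
    (fun α β hαβ => by simp [source4, hαβ]), hD]

theorem diagEinsteinAt_source5_iff {G : MetricField 3} {N : NCoeff 3} {U : Set (Coord 3)}
    {g : Fin 3 → Coord 3 → ℝ} {h : Fin 2 → Coord 3 → ℝ} {Ω : Coord 3 → ℝ}
    (H : IsConformallyDiagonal G N U g h Ω) (h0 : ∀ x, fderiv ℝ (g 0) x = 0)
    (h1 : ∀ i (x : Coord 3) (t : ℝ), g i (x + t • Pi.single (Sum.inl 0) 1) = g i x)
    {u : Coord 3} (hu : u ∈ U) {κ : ℝ} (hκ : κ ≠ 0) (Λ : ℝ) :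
    (DiagEinsteinAt G N κ (source5 κ Λ) u ↔
      ricciMixed G N (Sum.inl 1) (Sum.inl 1) u = -Λ ∧
        ricciMixed G N (Sum.inr 0) (Sum.inr 0) u = -Λ) ∧
    (EinsteinAt G N κ (source5 κ Λ) u ↔
      (ricciMixed G N (Sum.inl 1) (Sum.inl 1) u = -Λ ∧
        ricciMixed G N (Sum.inr 0) (Sum.inr 0) u = -Λ) ∧ MixedRicciVanishAt G N u) := by
  obtain ⟨hoff, hdiag⟩ := diagRicci_fin_two
    (e := fun i : Fin 2 => (Pi.single (Sum.inl i.succ) 1 : Coord 3)) (g := fun i => g i.succ)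
    (fun i => (H.g_smooth i.succ).contDiffAt (H.isOpen.mem_nhds hu)) (fun i => H.g_ne i.succ u hu)
  have hsucc := fun i j => diagRicci_succ
    (e := fun i : Fin 3 => (Pi.single (Sum.inl i) 1 : Coord 3)) h0
    (fun i => fderiv_apply_eq_zero_of_translation_invariant (h1 i)) i j u
  have hzero := fun (i j : Fin 3) (hij : i = 0 ∨ j = 0) => diagRicci_eq_zero_of_zero
    (e := fun i : Fin 3 => (Pi.single (Sum.inl i) 1 : Coord 3)) h0 h1 hij u
  have hvert := (H.diagRicci_vertical hu).2
  have hhor : ricciMixed G N (Sum.inl 1) (Sum.inl 1) u =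
      ricciMixed G N (Sum.inl 2) (Sum.inl 2) u := by
    have h11 := hsucc 0 0
    have h22 := hsucc 1 1
    simp only [Fin.succ_zero_eq_one, Fin.succ_one_eq_two] at h11 h22 hdiag
    simp only [H.ricciMixed_eq hu, H.ricci_inl_inl hu, Sum.elim_inl, mul_inv, mul_assoc, h11, h22,
      hdiag]
  have hflat : ricciMixed G N (Sum.inl 0) (Sum.inl 0) u = 0 := by
    rw [H.ricciMixed_eq hu, H.ricci_inl_inl hu, hzero 0 0 (Or.inl rfl), mul_zero]
  have hhoff : ∀ i j, i ≠ j → ricci G N (Sum.inl i) (Sum.inl j) u = 0 := by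
    intro i j hij
    rw [H.ricci_inl_inl hu]
    -- Either an index is the flat direction `x¹`, or both lie in the two-dimensional `(x², x³)`
    -- block.
    rcases Fin.eq_zero_or_eq_succ i with hi | ⟨i', rfl⟩
    · exact hzero i j (Or.inl hi)
    rcases Fin.eq_zero_or_eq_succ j with hj | ⟨j', rfl⟩
    · exact hzero _ j (Or.inr hj)
    rw [hsucc, hoff i' j' fun hc => hij (congrArg Fin.succ hc)]
  have hD : DiagEinsteinAt G N κ (source5 κ Λ) u ↔
      ricciMixed G N (Sum.inl 1) (Sum.inl 1) u = -Λ ∧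
        ricciMixed G N (Sum.inr 0) (Sum.inr 0) u = -Λ := by
    have hS := scalarCurv_of_diagonal (H.diag_ne_zero hu) (H.frameMetric_eq u)
    simp only [Fintype.sum_sum_type, Fin.sum_univ_two, Fin.sum_univ_three, ← hhor, ← hvert,
      hflat] at hS
    constructor
    · intro hE
      -- Two rows suffice; the `x¹` row is their sum, which is why its source must be `2Λ`.
      have h2 := hE (Sum.inl 1)
      have h4 := hE (Sum.inr 0)
      simp [source5, hS, mul_inv_cancel_left₀ hκ] at h2 h4
      constructor <;> linarith
    · rintro ⟨h2, h4⟩ (i | a)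
      · fin_cases i <;> simp [source5, hS, ← hhor, hflat, h2, h4, mul_inv_cancel_left₀ hκ] <;> ring
      · fin_cases a <;> simp [source5, hS, ← hvert, h2, h4, mul_inv_cancel_left₀ hκ] <;> ring
  refine ⟨hD, ?_⟩
  rw [H.einsteinAt_iff hu hhoff κ (fun α β hαβ => by simp [source5, hαβ]), hD]

end IsConformallyDiagonal

/-! ### Application to the 5D and 4D ansätze. -/

theorem Ansatz5.isConformallyDiagonal {U : Set (Coord 3)} (hU : IsOpen U) (A : Ansatz5 U)
    (C : ConformalData 3 U) (hC : ConfEq A.toAnholonomicData C) :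
    IsConformallyDiagonal (A.metricConf A.hcoeff C) (A.ncoeffConf C) U A.hcoeff
      (fun a u => liftXV C.Ω u ^ 2 * ![liftXV A.h₄, liftXV A.h₅] a u) (liftXV C.Ω) := by
  refine A.toAnholonomicData.isConformallyDiagonal hU C hC ?_ ?_ ?_
  · intro i
    fin_cases i
    exacts [contDiffOn_const, A.g₂_smooth, A.g₃_smooth]
  · intro i u hu
    fin_cases i
    · change A.g₁ ≠ 0
      rcases A.g₁_eq with h | h <;> simp [h]
    · exact A.g₂_ne u hu
    · exact A.g₃_ne u hu
  · intro i a u t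
    fin_cases i <;> simp [Ansatz5.hcoeff]

theorem Ansatz4.isConformallyDiagonal {U : Set (Coord 2)} (hU : IsOpen U) (A : Ansatz4 U)
    (C : ConformalData 2 U) (hC : ConfEq A.toAnholonomicData C) :
    IsConformallyDiagonal (A.metricConf A.hcoeff C) (A.ncoeffConf C) U A.hcoeff
      (fun a u => liftXV C.Ω u ^ 2 * ![liftXV A.h₄, liftXV A.h₅] a u) (liftXV C.Ω) := by
  refine A.toAnholonomicData.isConformallyDiagonal hU C hC ?_ ?_ ?_
  · exact Fin.forall_fin_two.2 ⟨A.g₂_smooth, A.g₃_smooth⟩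
  · exact Fin.forall_fin_two.2 ⟨A.g₂_ne, A.g₃_ne⟩
  · intro i a u t
    fin_cases i <;> simp [Ansatz4.hcoeff]

theorem Ansatz5.fderiv_hcoeff_zero {U : Set (Coord 3)} (A : Ansatz5 U) (x : Coord 3) :
    fderiv ℝ (A.hcoeff 0) x = 0 := by
  simp [Ansatz5.hcoeff]

theorem Ansatz5.hcoeff_add_smul_single_zero {U : Set (Coord 3)} (A : Ansatz5 U) (i : Fin 3)
    (x : Coord 3) (t : ℝ) :
    A.hcoeff i (x + t • Pi.single (Sum.inl 0) 1) = A.hcoeff i x := by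
  fin_cases i <;> simp [Ansatz5.hcoeff]

theorem corollary4 (κ Λ : ℝ) (hκ : κ ≠ 0) :
    -- the compatibility conditions
    Compatible5 (source5 κ Λ) ∧ Compatible4 (source4 κ Λ) ∧
    -- the 5D ansatz
    (∀ (U : Set (Coord 3)), IsOpen U → ∀ (A : Ansatz5 U), ∀ u ∈ U,
      (DiagEinsteinAt (A.metric A.hcoeff) A.ncoeff κ (source5 κ Λ) u ↔
        ricciMixed (A.metric A.hcoeff) A.ncoeff (Sum.inl 1) (Sum.inl 1) u = -Λ ∧
        ricciMixed (A.metric A.hcoeff) A.ncoeff (Sum.inr 0) (Sum.inr 0) u = -Λ) ∧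
      (EinsteinAt (A.metric A.hcoeff) A.ncoeff κ (source5 κ Λ) u ↔
        (ricciMixed (A.metric A.hcoeff) A.ncoeff (Sum.inl 1) (Sum.inl 1) u = -Λ ∧
          ricciMixed (A.metric A.hcoeff) A.ncoeff (Sum.inr 0) (Sum.inr 0) u = -Λ) ∧
        MixedRicciVanishAt (A.metric A.hcoeff) A.ncoeff u)) ∧
    -- the 4D ansatz
    (∀ (U : Set (Coord 2)), IsOpen U → ∀ (A : Ansatz4 U), ∀ u ∈ U,
      (DiagEinsteinAt (A.metric A.hcoeff) A.ncoeff κ (source4 κ Λ) u ↔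
        ricciMixed (A.metric A.hcoeff) A.ncoeff (Sum.inl 0) (Sum.inl 0) u = -Λ ∧
        ricciMixed (A.metric A.hcoeff) A.ncoeff (Sum.inr 0) (Sum.inr 0) u = -Λ) ∧
      (EinsteinAt (A.metric A.hcoeff) A.ncoeff κ (source4 κ Λ) u ↔
        (ricciMixed (A.metric A.hcoeff) A.ncoeff (Sum.inl 0) (Sum.inl 0) u = -Λ ∧
          ricciMixed (A.metric A.hcoeff) A.ncoeff (Sum.inr 0) (Sum.inr 0) u = -Λ) ∧
        MixedRicciVanishAt (A.metric A.hcoeff) A.ncoeff u)) ∧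
    -- the conformal 5D ansatz
    (∀ (U : Set (Coord 3)), IsOpen U → ∀ (A : Ansatz5 U) (C : ConformalData 3 U),
      ConfEq A.toAnholonomicData C → ∀ u ∈ U,
      (DiagEinsteinAt (A.metricConf A.hcoeff C) (A.ncoeffConf C) κ (source5 κ Λ) u ↔
        ricciMixed (A.metricConf A.hcoeff C) (A.ncoeffConf C) (Sum.inl 1) (Sum.inl 1) u = -Λ ∧
        ricciMixed (A.metricConf A.hcoeff C) (A.ncoeffConf C) (Sum.inr 0) (Sum.inr 0) u = -Λ) ∧
      (EinsteinAt (A.metricConf A.hcoeff C) (A.ncoeffConf C) κ (source5 κ Λ) u ↔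
        (ricciMixed (A.metricConf A.hcoeff C) (A.ncoeffConf C) (Sum.inl 1) (Sum.inl 1) u = -Λ ∧
          ricciMixed (A.metricConf A.hcoeff C) (A.ncoeffConf C) (Sum.inr 0) (Sum.inr 0) u = -Λ) ∧
        MixedRicciVanishAt (A.metricConf A.hcoeff C) (A.ncoeffConf C) u)) ∧
    -- the conformal 4D ansatz
    (∀ (U : Set (Coord 2)), IsOpen U → ∀ (A : Ansatz4 U) (C : ConformalData 2 U),
      ConfEq A.toAnholonomicData C → ∀ u ∈ U,
      (DiagEinsteinAt (A.metricConf A.hcoeff C) (A.ncoeffConf C) κ (source4 κ Λ) u ↔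
        ricciMixed (A.metricConf A.hcoeff C) (A.ncoeffConf C) (Sum.inl 0) (Sum.inl 0) u = -Λ ∧
        ricciMixed (A.metricConf A.hcoeff C) (A.ncoeffConf C) (Sum.inr 0) (Sum.inr 0) u = -Λ) ∧
      (EinsteinAt (A.metricConf A.hcoeff C) (A.ncoeffConf C) κ (source4 κ Λ) u ↔
        (ricciMixed (A.metricConf A.hcoeff C) (A.ncoeffConf C) (Sum.inl 0) (Sum.inl 0) u = -Λ ∧
          ricciMixed (A.metricConf A.hcoeff C) (A.ncoeffConf C) (Sum.inr 0) (Sum.inr 0) u = -Λ) ∧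
        MixedRicciVanishAt (A.metricConf A.hcoeff C) (A.ncoeffConf C) u)) := by
  have h5 : ∀ (U : Set (Coord 3)), IsOpen U → ∀ (A : Ansatz5 U) (C : ConformalData 3 U),
      ConfEq A.toAnholonomicData C → ∀ u ∈ U, _ := fun U hU A C hC u hu =>
    (A.isConformallyDiagonal hU C hC).diagEinsteinAt_source5_iff A.fderiv_hcoeff_zero
      A.hcoeff_add_smul_single_zero hu hκ Λ
  have h4 : ∀ (U : Set (Coord 2)), IsOpen U → ∀ (A : Ansatz4 U) (C : ConformalData 2 U),
      ConfEq A.toAnholonomicData C → ∀ u ∈ U, _ := fun U hU A C hC u hu =>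
    (A.isConformallyDiagonal hU C hC).diagEinsteinAt_source4_iff hu hκ Λ
  refine ⟨?_, ?_, fun U hU A u hu => ?_, fun U hU A u hu => ?_, h5, h4⟩
  · simp [Compatible5, source5]
    ring
  · simp [Compatible4, source4]
  -- The ansatz without conformal factor is the conformal one with `Ω = 1`, `ζ = 0`.
  · have := h5 U hU A _ (confEq_trivial _) u hu
    rwa [A.metricConf_trivial, A.ncoeffConf_trivial] at this
  · have := h4 U hU A _ (confEq_trivial _) u hu
    rwa [A.metricConf_trivial, A.ncoeffConf_trivial] at this
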